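/- Let $k$ be an algebraically closed field and let $n\ge 2$ be an integer. Let $\mathrm{Bir}(\mathbb{P}^n_k)$ be the group of birational self-maps of $\mathbb{P}^n_k$, let $\mathrm{Aut}(\mathbb{P}^n_k)\subset\mathrm{Bir}(\mathbb{P}^n_k)$ be the subgroup of automorphisms of $\mathbb{P}^n_k$, and let $\sigma_n\in\mathrm{Bir}(\mathbb{P}^n_k)$ be the standard involution $$(z_0:z_1:\ldots:z_n)\dashrightarrow\Big(\prod_{i\neq 0}z_i:\prod_{i\neq 1}z_i:\ldots:\prod_{i\neq n}z_i\Big).$$ Let $G_n(k)=\langle\sigma_n,\mathrm{Aut}(\mathbb{P}^n_k)\rangle$ be the subgroup of $\mathrm{Bir}(\mathbb{P}^n_k)$ generated by $\sigma_n$ and $\mathrm{Aut}(\mathbb{P}^n_k)$. Then $G_n(k)$ has no nontrivial finite-dimensional linear representation over any field: for every field $F$ and every finite-dimensional $F$-vector space $V$, every group homomorphism $\rho\colon G_n(k)\to\mathrm{GL}(V)$ is trivial, that is, $\rho(g)=\mathrm{id}_V$ for all $g\in G_n(k)$. -/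

import Mathlib

namespace Cremona

/-- A representative of a dominant rational self-map
`(z₀ : … : zₙ) ⇢ (φ₀(z) : … : φₙ(z))` of `ℙⁿ` over `k`: a tuple of homogeneous polynomials of the
same degree.  The map is dominant exactly when `φ₀, …, φₙ` are algebraically independent; in
particular they are then nonzero and of positive degree.  Common factors are allowed in
a representative, since they disappear in the quotient `DomRat`. -/
structure RatTuple (k : Type*) [Field k] (n : ℕ) where
  /-- the coordinates `φ₀, …, φₙ` -/
  coord : Fin (n + 1) → MvPolynomial (Fin (n + 1)) k
  homogeneous : ∃ d : ℕ, ∀ i, (coord i).IsHomogeneous d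
  dominant : AlgebraicIndependent k coord

variable {k : Type*} [Field k] {n : ℕ}

namespace RatTuple

theorem coord_ne_zero (φ : RatTuple k n) (i : Fin (n + 1)) : φ.coord i ≠ 0 :=
  φ.dominant.ne_zero i

/-- Two tuples define the same rational map when they are proportional:
`(φ₀ : … : φₙ) = (ψ₀ : … : ψₙ)` over the function field. -/
instance setoid (k : Type*) [Field k] (n : ℕ) : Setoid (RatTuple k n) where
  r φ ψ := ∀ i j, φ.coord i * ψ.coord j = φ.coord j * ψ.coord i
  iseqv :=
    { refl := fun φ i j => mul_comm _ _
      symm := fun {φ ψ} h i j => by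
        linear_combination h j i
      trans := fun {φ ψ χ} h h' i j => by
        apply mul_left_cancel₀ (ψ.coord_ne_zero i)
        linear_combination φ.coord i * h' i j + χ.coord i * h i j }

/-- The identity `(z₀ : … : zₙ)`. -/
noncomputable def id (k : Type*) [Field k] (n : ℕ) : RatTuple k n where
  coord := MvPolynomial.X
  homogeneous := ⟨1, fun i => MvPolynomial.isHomogeneous_X k i⟩
  dominant := MvPolynomial.algebraicIndependent_X _ _

/-- The composition `φ ∘ ψ`: substitute the coordinates of `ψ` in those of `φ`. -/
noncomputable def comp (φ ψ : RatTuple k n) : RatTuple k n where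
  coord i := MvPolynomial.aeval ψ.coord (φ.coord i)
  homogeneous := by
    obtain ⟨d, hd⟩ := φ.homogeneous
    obtain ⟨e, he⟩ := ψ.homogeneous
    exact ⟨e * d, fun i => (hd i).aeval ψ.coord he⟩
  dominant := by
    have h := φ.dominant.map' (f := MvPolynomial.aeval ψ.coord) ψ.dominant
    exact h

theorem comp_congr {φ φ' ψ ψ' : RatTuple k n} (h : φ ≈ φ') (h' : ψ ≈ ψ') :
    φ.comp ψ ≈ φ'.comp ψ' := by
  have h1 : φ.comp ψ ≈ φ'.comp ψ := fun i j => by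
    simp only [comp, ← map_mul, h i j]
  have h2 : φ'.comp ψ ≈ φ'.comp ψ' := by
    obtain ⟨d, hd⟩ := φ'.homogeneous
    have key : ∀ i, ψ'.coord 0 ^ d * MvPolynomial.aeval ψ.coord (φ'.coord i)
        = ψ.coord 0 ^ d * MvPolynomial.aeval ψ'.coord (φ'.coord i) := by
      intro i
      have hs : ∀ (c : MvPolynomial (Fin (n + 1)) k)
          (v : Fin (n + 1) → MvPolynomial (Fin (n + 1)) k),
          MvPolynomial.aeval (fun l => c * v l) (φ'.coord i)
            = c ^ d * MvPolynomial.aeval v (φ'.coord i) := by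
        intro c v
        rw [MvPolynomial.aeval_def, MvPolynomial.aeval_def, MvPolynomial.eval₂_eq',
          MvPolynomial.eval₂_eq', Finset.mul_sum]
        refine Finset.sum_congr rfl fun m hm => ?_
        have hdeg : ∑ l, m l = d := by
          have := hd i (MvPolynomial.mem_support_iff.mp hm)
          rw [Finsupp.weight_apply, Finsupp.sum_fintype _ _ (by simp)] at this
          simpa using this
        simp only [mul_pow, Finset.prod_mul_distrib, Finset.prod_pow_eq_pow_sum, hdeg]
        ring
      rw [← hs, ← hs]
      congr 2
      funext l
      linear_combination - h' 0 l
    intro i j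
    apply mul_left_cancel₀ (pow_ne_zero d (ψ'.coord_ne_zero 0))
    simp only [comp]
    linear_combination MvPolynomial.aeval ψ'.coord (φ'.coord j) * key i
      - MvPolynomial.aeval ψ'.coord (φ'.coord i) * key j
  exact Setoid.trans h1 h2

end RatTuple

/-- The dominant rational self-maps of `ℙⁿ` over `k`. -/
def DomRat (k : Type*) [Field k] (n : ℕ) : Type _ := Quotient (RatTuple.setoid k n)

/-- The rational map given by a tuple. -/
def DomRat.mk (φ : RatTuple k n) : DomRat k n := Quotient.mk (RatTuple.setoid k n) φ

/-- Dominant rational self-maps form a monoid under composition. -/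
noncomputable instance : Monoid (DomRat k n) where
  mul := Quotient.map₂ RatTuple.comp fun _ _ h _ _ h' => RatTuple.comp_congr h h'
  one := DomRat.mk (RatTuple.id k n)
  mul_assoc f g h := by
    induction f using Quotient.inductionOn
    induction g using Quotient.inductionOn
    induction h using Quotient.inductionOn
    refine congrArg (Quotient.mk _) ?_
    simp only [RatTuple.comp, RatTuple.mk.injEq]
    funext i
    rw [← AlgHom.comp_apply, MvPolynomial.comp_aeval]
  one_mul f := by
    induction f using Quotient.inductionOn
    refine congrArg (Quotient.mk _) ?_
    simp [RatTuple.comp, RatTuple.id]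
  mul_one f := by
    induction f using Quotient.inductionOn
    refine congrArg (Quotient.mk _) ?_
    simp [RatTuple.comp, RatTuple.id]

/-- The group `Bir(ℙⁿ)` of birational self-maps: the rational self-maps which admit a rational
inverse (such maps are dominant). -/
abbrev Bir (k : Type*) [Field k] (n : ℕ) : Type _ := (DomRat k n)ˣ

/-- A rational self-map is a morphism (regular everywhere, for `k` algebraically closed) when it
is given by homogeneous polynomials of the same degree without a common zero in `ℙⁿ(k)`. -/
def DomRat.IsMorphism (f : DomRat k n) : Prop :=
  ∃ φ : RatTuple k n, DomRat.mk φ = f ∧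
    ∀ p : Fin (n + 1) → k, p ≠ 0 → ∃ i, MvPolynomial.eval p (φ.coord i) ≠ 0

theorem DomRat.IsMorphism.one : (1 : DomRat k n).IsMorphism :=
  ⟨RatTuple.id k n, rfl, fun p hp => by
    obtain ⟨i, hi⟩ := Function.ne_iff.mp hp
    exact ⟨i, by simpa [RatTuple.id] using hi⟩⟩

theorem DomRat.IsMorphism.mul {f g : DomRat k n} (hf : f.IsMorphism) (hg : g.IsMorphism) :
    (f * g).IsMorphism := by
  obtain ⟨φ, rfl, hφ⟩ := hf
  obtain ⟨ψ, rfl, hψ⟩ := hg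
  refine ⟨φ.comp ψ, rfl, fun p hp => ?_⟩
  obtain ⟨j, hj⟩ := hψ p hp
  obtain ⟨i, hi⟩ := hφ (fun l => MvPolynomial.eval p (ψ.coord l)) (Function.ne_iff.mpr ⟨j, hj⟩)
  refine ⟨i, ?_⟩
  simp only [RatTuple.comp]
  rw [← MvPolynomial.coe_aeval_eq_eval] at hi ⊢
  simp only [RingHom.coe_coe] at hi ⊢
  rw [← AlgHom.comp_apply, MvPolynomial.comp_aeval]
  simpa [MvPolynomial.coe_aeval_eq_eval] using hi

/-- `Aut(ℙⁿ)` for `k` algebraically closed: the birational self-maps that are morphisms together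
with their inverse. -/
def autProj (k : Type*) [Field k] (n : ℕ) : Subgroup (Bir k n) where
  carrier := {f | (f : DomRat k n).IsMorphism ∧ ((f⁻¹ : Bir k n) : DomRat k n).IsMorphism}
  one_mem' := ⟨by simpa using DomRat.IsMorphism.one, by simpa using DomRat.IsMorphism.one⟩
  mul_mem' := fun {f g} hf hg => ⟨by simpa using hf.1.mul hg.1, by
    rw [mul_inv_rev, Units.val_mul]
    exact hg.2.mul hf.2⟩
  inv_mem' := fun {f} hf => ⟨hf.2, by simpa using hf.1⟩

/-- The tuple `(∏_{j ≠ 0} zⱼ, …, ∏_{j ≠ n} zⱼ)`, for `n ≥ 1`. -/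
noncomputable def sigmaTuple (k : Type*) [Field k] (n : ℕ) (hn : 0 < n) : RatTuple k n where
  coord i := ∏ j ∈ Finset.univ.erase i, MvPolynomial.X j
  homogeneous := ⟨n, fun i => by
    have h := MvPolynomial.IsHomogeneous.prod (R := k) (Finset.univ.erase i)
      (fun j => MvPolynomial.X j) (fun _ => 1) (fun j _ => MvPolynomial.isHomogeneous_X k j)
    simpa [Finset.card_erase_of_mem] using h⟩
  dominant := by
    -- `z^a` is sent to `z^(e a)`, where `(e a)ₗ` is the sum of the `aⱼ`, `j ≠ l`
    let e : (Fin (n + 1) →₀ ℕ) →+ (Fin (n + 1) →₀ ℕ) :=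
      { toFun := fun a => Finsupp.equivFunOnFinite.symm fun l => ∑ j ∈ Finset.univ.erase l, a j
        map_zero' := by ext l; simp
        map_add' := fun a b => by ext l; simp [Finset.sum_add_distrib] }
    have he1 : ∀ a l, a l + e a l = ∑ j, a j := fun a l =>
      Finset.add_sum_erase _ _ (Finset.mem_univ l)
    have he2 : ∀ a, ∑ l, e a l = n * ∑ j, a j := fun a => by
      have h := Finset.sum_congr rfl fun l (_ : l ∈ Finset.univ) => he1 a l
      rw [Finset.sum_add_distrib, Finset.sum_const, Finset.card_univ, Fintype.card_fin,
        smul_eq_mul] at h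
      linarith
    have he : Function.Injective e := fun a b hab => by
      have h : ∑ j, a j = ∑ j, b j :=
        Nat.eq_of_mul_eq_mul_left hn (by rw [← he2, ← he2, hab])
      ext l
      have h1 := he1 a l
      have h2 := he1 b l
      rw [hab] at h1
      omega
    let m : MvPolynomial (Fin (n + 1)) k →ₐ[k] MvPolynomial (Fin (n + 1)) k :=
      AddMonoidAlgebra.mapDomainAlgHom k k e
    have hm : MvPolynomial.aeval (fun i => ∏ j ∈ Finset.univ.erase i, MvPolynomial.X j) = m := by
      refine MvPolynomial.algHom_ext fun i => ?_
      rw [MvPolynomial.aeval_X]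
      have h1 : m (MvPolynomial.X i) = MvPolynomial.monomial (e (Finsupp.single i 1)) 1 :=
        AddMonoidAlgebra.mapDomain_single
      have h2 : e (Finsupp.single i 1) = ∑ j ∈ Finset.univ.erase i, Finsupp.single j 1 := by
        ext l
        simp [e, Finsupp.single_apply, Finsupp.finsetSum_apply, eq_comm]
      rw [h1, h2, MvPolynomial.monomial_sum_one]
      rfl
    change Function.Injective (MvPolynomial.aeval _)
    rw [hm]
    exact AddMonoidAlgebra.mapDomain_injective he

/-- The standard involution `σₙ`, for `n ≥ 1`. -/
noncomputable def sigma (k : Type*) [Field k] (n : ℕ) (hn : 0 < n) : Bir k n :=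
  have h : DomRat.mk (sigmaTuple k n hn) * DomRat.mk (sigmaTuple k n hn) = 1 := by
    refine Quotient.sound fun i j => ?_
    set s := sigmaTuple k n hn with hs
    have hP : ∀ l, MvPolynomial.X l * s.coord l = ∏ m, MvPolynomial.X m := fun l =>
      Finset.mul_prod_erase _ _ (Finset.mem_univ l)
    have hQ : ∀ l, s.coord l * (s.comp s).coord l = ∏ m, s.coord m := fun l => by
      have : (s.comp s).coord l = ∏ m ∈ Finset.univ.erase l, s.coord m := by
        simp only [RatTuple.comp]
        conv_lhs => rw [show s.coord l = ∏ j ∈ Finset.univ.erase l, MvPolynomial.X j from rfl]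
        simp
      rw [this]
      exact Finset.mul_prod_erase _ _ (Finset.mem_univ l)
    apply mul_left_cancel₀ (s.coord_ne_zero i)
    apply mul_left_cancel₀ (s.coord_ne_zero j)
    change _ * (_ * (_ * MvPolynomial.X j)) = _ * (_ * (_ * MvPolynomial.X i))
    linear_combination s.coord j * MvPolynomial.X j * hQ i - s.coord i * MvPolynomial.X i * hQ j
      + (∏ m, s.coord m) * (hP j - hP i)
  ⟨DomRat.mk (sigmaTuple k n hn), DomRat.mk (sigmaTuple k n hn), h, h⟩

/-- The group `Gₙ(k) = ⟨σₙ, Aut(ℙⁿ)⟩`, a subgroup of `Bir(ℙⁿ)`. -/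
noncomputable def G (k : Type*) [Field k] (n : ℕ) (hn : 0 < n) : Subgroup (Bir k n) :=
  Subgroup.closure ({sigma k n hn} ∪ (autProj k n : Set (Bir k n)))

end Cremona

namespace Cremona

open MvPolynomial Matrix

/-! ### Values of rational maps at points and at the generic point -/

section Sends

variable {k : Type*} [Field k] {n : ℕ} {L : Type*} [Field L] [Algebra k L]

/-! A Heisenberg group of large prime exponent sits inside `G`. In the affine coordinates `x = z_b /
z_a`, `yᵢ = zᵢ / z_a`, the monomial map `(x, yᵢ) ↦ (x, x yᵢ)` and the scaling of `x` by a root of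
unity `ζ` have as commutator the scaling of all `yᵢ` by `ζ`, which commutes with both. If `ζ` has
prime order `l` larger than `dim V` and the characteristics of `k` and `F`, any representation kills
this commutator: on an eigenspace of eigenvalue `μ`, determinants give `μ ^ dim = 1`, while `μ ^ l =
1` (`Module.End.eq_one_of_central_commutator`).

The monomial map lies in `G` because it is a product of two fibrewise inversions, each obtained from
`σₙ` by composing with linear maps (`fibreMul`). For `n ≥ 2` there is at least one `yᵢ`, so the
commutator is a nonscalar diagonal matrix. A normal subgroup of `GLₙ₊₁` containing it and the
scalars is everything (`Matrix.normal_GL_eq_top`), so all linear maps act trivially.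

Finally, with `h : x ↦ 1 - x` in affine coordinates, `(h σₙ)³ = 1` (`oneSub_mul_sigma_pow_three`).
Thus `ρ(σₙ)³ = 1 = ρ(σₙ)²`, so `ρ(σₙ) = 1`. Automorphisms of `ℙⁿ` are linear
(`exists_linear_of_mem_autProj`), so these elements generate `G`. -/

theorem aeval_const_mul {σ : Type*} {p : MvPolynomial σ k} {d : ℕ} (hp : p.IsHomogeneous d)
    (c : L) (v : σ → L) : aeval (fun l => c * v l) p = c ^ d * aeval v p := by
  rw [aeval_def, aeval_def, eval₂_eq, eval₂_eq, Finset.mul_sum]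
  refine Finset.sum_congr rfl fun m hm => ?_
  have hdeg : ∑ l ∈ m.support, m l = d := by
    have := hp (mem_support_iff.mp hm)
    rw [Finsupp.weight_apply] at this
    simpa [Finsupp.sum] using this
  simp only [mul_pow, Finset.prod_mul_distrib, Finset.prod_pow_eq_pow_sum, hdeg]
  ring

/-- The rational map `f` is defined at the point of `ℙⁿ(L)` with coordinates `v` and sends it to
the point with coordinates `w`. -/
def Sends (f : DomRat k n) (v w : Fin (n + 1) → L) : Prop :=
  ∃ φ : RatTuple k n, DomRat.mk φ = f ∧ ∃ c : L, c ≠ 0 ∧ ∀ i, aeval v (φ.coord i) = c * w i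

namespace Sends

theorem mul {f g : DomRat k n} {v w x : Fin (n + 1) → L} (hf : Sends f w x) (hg : Sends g v w) :
    Sends (f * g) v x := by
  obtain ⟨φ, rfl, c, hc, hφ⟩ := hf
  obtain ⟨ψ, rfl, e, he, hψ⟩ := hg
  obtain ⟨d, hd⟩ := φ.homogeneous
  refine ⟨φ.comp ψ, rfl, e ^ d * c, mul_ne_zero (pow_ne_zero _ he) hc, fun i => ?_⟩
  simp only [RatTuple.comp]
  rw [← AlgHom.comp_apply, comp_aeval]
  simp only [hψ, aeval_const_mul (hd i), hφ, mul_assoc]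

theorem of_smul {f : DomRat k n} {v w w' : Fin (n + 1) → L} (hf : Sends f v w) (c : L)
    (hc : c ≠ 0) (h : ∀ i, w i = c * w' i) : Sends f v w' := by
  obtain ⟨φ, rfl, e, he, hφ⟩ := hf
  exact ⟨φ, rfl, e * c, mul_ne_zero he hc, fun i => by rw [hφ, h, mul_assoc]⟩

theorem one (v : Fin (n + 1) → L) : Sends (1 : DomRat k n) v v :=
  ⟨RatTuple.id k n, rfl, 1, one_ne_zero, fun i => by simp [RatTuple.id]⟩

end Sends

/-- The coordinates of the generic point of `ℙⁿ`. -/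
noncomputable def genericPoint (k : Type*) [Field k] (n : ℕ) :
    Fin (n + 1) → FractionRing (MvPolynomial (Fin (n + 1)) k) :=
  fun i => algebraMap _ _ (X i : MvPolynomial (Fin (n + 1)) k)

theorem aeval_genericPoint (p : MvPolynomial (Fin (n + 1)) k) :
    aeval (genericPoint k n) p = algebraMap _ (FractionRing (MvPolynomial (Fin (n + 1)) k)) p := by
  have h := aeval_algebraMap_apply (FractionRing (MvPolynomial (Fin (n + 1)) k))
    (X : Fin (n + 1) → MvPolynomial (Fin (n + 1)) k) p
  rw [aeval_X_left_apply] at h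
  exact h

/-- Evaluating at the generic point embeds the coordinate polynomials in their fraction field, so no
information is lost. Every identity in `G` below is checked this way. -/
theorem Sends.eq_of_genericPoint {f g : DomRat k n}
    {w : Fin (n + 1) → FractionRing (MvPolynomial (Fin (n + 1)) k)}
    (hf : Sends f (genericPoint k n) w) (hg : Sends g (genericPoint k n) w) : f = g := by
  obtain ⟨φ, rfl, c, hc, hφ⟩ := hf
  obtain ⟨ψ, rfl, e, he, hψ⟩ := hg
  refine Quotient.sound fun i j => ?_
  apply IsFractionRing.injective (MvPolynomial (Fin (n + 1)) k)
    (FractionRing (MvPolynomial (Fin (n + 1)) k))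
  simp only [map_mul, ← aeval_genericPoint, hφ, hψ]
  ring

theorem aeval_genericPoint_ne_zero {p : MvPolynomial (Fin (n + 1)) k} (hp : p ≠ 0) :
    aeval (genericPoint k n) p ≠ 0 := by
  rw [aeval_genericPoint]
  exact (map_ne_zero_iff _ (IsFractionRing.injective _ _)).mpr hp

theorem genericPoint_ne_zero (i : Fin (n + 1)) : genericPoint k n i ≠ 0 := by
  simpa using aeval_genericPoint_ne_zero (k := k) (X_ne_zero i)

theorem algebraMap_mul_genericPoint_ne {a b : Fin (n + 1)} (hab : a ≠ b) (s : k) :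
    algebraMap k _ s * genericPoint k n b ≠ genericPoint k n a := by
  have h : (C s * X b - X a : MvPolynomial (Fin (n + 1)) k) ≠ 0 := by
    intro h
    have := congrArg (eval (Pi.single a 1)) h
    simp [hab.symm] at this
  simpa [sub_ne_zero] using aeval_genericPoint_ne_zero (k := k) h

theorem sends_sigma (hn : 0 < n) {v : Fin (n + 1) → L} (hv : ∀ i, v i ≠ 0) :
    Sends (sigma k n hn : DomRat k n) v (fun i => (v i)⁻¹) := by
  refine ⟨sigmaTuple k n hn, rfl, ∏ i, v i, Finset.prod_ne_zero_iff.mpr fun i _ => hv i,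
    fun i => ?_⟩
  rw [eq_mul_inv_iff_mul_eq₀ (hv i)]
  simpa [sigmaTuple] using Finset.prod_erase_mul _ _ (Finset.mem_univ i)

end Sends

/-! ### Automorphisms of projective space are linear -/

section Linear

variable {k : Type*} [Field k] {n : ℕ}

theorem aeval_sum_C_mul_X (A B : Matrix (Fin (n + 1)) (Fin (n + 1)) k) (i : Fin (n + 1)) :
    aeval (fun i => ∑ j, C (B i j) * X j : Fin (n + 1) → MvPolynomial (Fin (n + 1)) k)
      (∑ j, C (A i j) * X j) = ∑ j, C ((A * B) i j) * X j := by
  simp only [map_sum, map_mul, aeval_X, algHom_C, algebraMap_eq, Finset.mul_sum, Matrix.mul_apply,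
    Finset.sum_mul, mul_assoc]
  exact Finset.sum_comm

/-- The tuple of linear forms given by an invertible matrix. -/
noncomputable def linearTuple (A : GL (Fin (n + 1)) k) : RatTuple k n where
  coord i := ∑ j, C (A i j) * X j
  homogeneous := ⟨1, fun i => IsHomogeneous.sum _ _ _ fun j _ => isHomogeneous_C_mul_X _ _⟩
  dominant := by
    change Function.Injective (aeval _)
    -- Substituting the linear forms of the inverse matrix undoes the substitution.
    apply Function.LeftInverse.injective
      (g := aeval (fun i => ∑ j, C (A⁻¹ i j) * X j))
    intro p
    rw [← AlgHom.comp_apply, comp_aeval]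
    simp only [aeval_sum_C_mul_X]
    simp only [← Matrix.GeneralLinearGroup.coe_mul, mul_inv_cancel]
    simp [Matrix.one_apply]

/-- The linear action of `GLₙ₊₁` on `ℙⁿ`. -/
noncomputable def linear (k : Type*) [Field k] (n : ℕ) : GL (Fin (n + 1)) k →* Bir k n :=
  MonoidHom.toHomUnits
    { toFun := fun A => DomRat.mk (linearTuple A)
      map_one' := by
        refine Quotient.sound fun i j => ?_
        simp [linearTuple, RatTuple.id, Matrix.one_apply, mul_comm]
      map_mul' := fun A B => by
        change _ = DomRat.mk ((linearTuple A).comp (linearTuple B))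
        congr 1
        simp only [linearTuple, RatTuple.comp, RatTuple.mk.injEq]
        funext i
        rw [aeval_sum_C_mul_X, Matrix.GeneralLinearGroup.coe_mul] }

theorem linear_coe (A : GL (Fin (n + 1)) k) :
    (linear k n A : DomRat k n) = DomRat.mk (linearTuple A) := rfl

theorem sends_linear {L : Type*} [Field L] [Algebra k L] (A : GL (Fin (n + 1)) k)
    (v : Fin (n + 1) → L) :
    Sends (linear k n A : DomRat k n) v (fun i => ∑ j, algebraMap k L (A i j) * v j) :=
  ⟨linearTuple A, rfl, 1, one_ne_zero, fun i => by simp [linearTuple]⟩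

theorem linear_isMorphism (A : GL (Fin (n + 1)) k) :
    (linear k n A : DomRat k n).IsMorphism := by
  refine ⟨linearTuple A, rfl, fun p hp => ?_⟩
  by_contra! h
  apply hp
  have hA : A.1 *ᵥ p = 0 := by
    funext i
    simpa [linearTuple, Matrix.mulVec, dotProduct] using h i
  calc p = (A⁻¹.1 * A.1) *ᵥ p := by simp
    _ = 0 := by rw [← Matrix.mulVec_mulVec, hA, Matrix.mulVec_zero]

theorem linear_mem_autProj (A : GL (Fin (n + 1)) k) : linear k n A ∈ autProj k n :=
  ⟨linear_isMorphism A, by rw [← map_inv]; exact linear_isMorphism A⁻¹⟩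

theorem linear_scalar (c : kˣ) : linear k n (GeneralLinearGroup.scalar _ c) = 1 := by
  refine Units.ext (Quotient.sound fun i j => ?_)
  have h : ∀ i, ∑ j, C ((GeneralLinearGroup.scalar (Fin (n + 1)) c).1 i j) * X j
      = (C (c : k) * X i : MvPolynomial (Fin (n + 1)) k) := fun i => by
    rw [Finset.sum_eq_single i]
    · simp [GeneralLinearGroup.coe_scalar]
    · intro j _ hj
      simp [GeneralLinearGroup.coe_scalar, hj.symm]
    · simp
  change (∑ j, _) * X j = (∑ j, _) * X i
  rw [h, h]
  ring

/-- By the Nullstellensatz every variable lies in the radical of `(c)`, so `c` divides powers of two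
coprime variables. -/
theorem isUnit_of_eval_eq_zero_imp [IsAlgClosed k] {σ : Type*} [Finite σ] {a b : σ} (hab : a ≠ b)
    {c : MvPolynomial σ k} (hc : ∀ p : σ → k, eval p c = 0 → p = 0) : IsUnit c := by
  have key : ∀ i : σ, ∃ m : ℕ, c ∣ X i ^ m := fun i => by
    have h : (X i : MvPolynomial σ k) ∈ (Ideal.span {c}).radical := by
      rw [← vanishingIdeal_zeroLocus_eq_radical (K := k)]
      intro p hp
      have h0 : eval p c = 0 := by
        simpa [MvPolynomial.aeval_eq_eval] using hp c (Ideal.mem_span_singleton_self c)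
      simp [hc p h0]
    obtain ⟨m, hm⟩ := h
    exact ⟨m, Ideal.mem_span_singleton.mp hm⟩
  obtain ⟨m, hm⟩ := key a
  obtain ⟨m', hm'⟩ := key b
  have h : IsRelPrime (X a : MvPolynomial σ k) (X b) :=
    ((X_prime (R := k)).irreducible.isRelPrime_iff_not_dvd).mpr fun h => hab (X_dvd_X.mp h)
  exact h.pow hm hm'

/-- Proportionality to the identity forces `φᵢ = c Xᵢ` with a common factor `c`; a zero of `c` away
from the origin would be a common zero, so `c` is constant. -/
theorem RatTuple.degree_eq_one [IsAlgClosed k] (hn : 0 < n) (φ : RatTuple k n) {d : ℕ}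
    (hd : ∀ i, (φ.coord i).IsHomogeneous d)
    (h : ∀ i j, φ.coord i * X j = φ.coord j * X i)
    (hφ : ∀ p : Fin (n + 1) → k, p ≠ 0 → ∃ i, eval p (φ.coord i) ≠ 0) : d = 1 := by
  have h01 : (0 : Fin (n + 1)) ≠ Fin.last n := by
    rw [Ne, Fin.ext_iff]; simpa using hn.ne
  obtain ⟨c, hc⟩ : (X 0 : MvPolynomial (Fin (n + 1)) k) ∣ φ.coord 0 :=
    ((X_prime (R := k)).dvd_or_dvd (Dvd.intro_left _ (h 0 (Fin.last n)).symm)).resolve_right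
      fun h' => h01 (X_dvd_X.mp h')
  have hci : ∀ i, φ.coord i = c * X i := fun i => by
    apply mul_right_cancel₀ (X_ne_zero (R := k) (0 : Fin (n + 1)))
    rw [h i 0, hc]; ring
  have hcu : IsUnit c := isUnit_of_eval_eq_zero_imp h01 fun p hp => by
    by_contra hp0
    obtain ⟨i, hi⟩ := hφ p hp0
    simp [hci, hp] at hi
  obtain ⟨r, -, rfl⟩ := isUnit_iff_eq_C_of_isReduced.mp hcu
  refine (hd 0).inj_right ?_ (φ.coord_ne_zero 0)
  rw [hci]
  exact isHomogeneous_C_mul_X _ _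

theorem exists_linear_of_mem_autProj [IsAlgClosed k] (hn : 0 < n) {f : Bir k n}
    (hf : f ∈ autProj k n) : ∃ A, linear k n A = f := by
  obtain ⟨⟨φ, hφ, hφ0⟩, ψ, hψ, hψ0⟩ := hf
  obtain ⟨d, hd⟩ := φ.homogeneous
  obtain ⟨e, he⟩ := ψ.homogeneous
  have hcomp : φ.comp ψ ≈ RatTuple.id k n := by
    refine Quotient.exact ?_
    change DomRat.mk φ * DomRat.mk ψ = 1
    rw [hφ, hψ, ← Units.val_mul, mul_inv_cancel, Units.val_one]
  -- Degrees multiply under substitution, and the composite still has no common zero.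
  have hde : e * d = 1 := by
    refine (φ.comp ψ).degree_eq_one hn (fun i => (hd i).aeval ψ.coord he) hcomp fun p hp => ?_
    obtain ⟨j, hj⟩ := hψ0 p hp
    obtain ⟨i, hi⟩ := hφ0 (fun l => eval p (ψ.coord l)) (Function.ne_iff.mpr ⟨j, hj⟩)
    refine ⟨i, ?_⟩
    simp only [RatTuple.comp]
    rw [← aeval_eq_eval] at hi ⊢
    rw [← AlgHom.comp_apply, comp_aeval]
    simpa [aeval_eq_eval] using hi
  obtain rfl : d = 1 := Nat.eq_one_of_mul_eq_one_left hde
  have hlin : ∀ i, ∃ r : Fin (n + 1) → k, ∑ j, r j • X j = φ.coord i := fun i => by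
    have := (mem_homogeneousSubmodule 1 _).mpr (hd i)
    rw [homogeneousSubmodule_one_eq_span_X] at this
    exact (Submodule.mem_span_range_iff_exists_fun k).mp this
  choose A hA using hlin
  -- A left kernel vector would be a linear relation among the algebraically independent
  -- coordinates.
  have hdet : Matrix.det (Matrix.of A) ≠ 0 := by
    intro h0
    obtain ⟨v, hv, hv0⟩ := Matrix.exists_vecMul_eq_zero_iff.mpr h0
    have hli := Fintype.linearIndependent_iff.mp φ.dominant.linearIndependent v (by
      simp only [← hA, Finset.smul_sum, smul_smul]
      rw [Finset.sum_comm]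
      simp only [← Finset.sum_smul]
      refine Finset.sum_eq_zero fun j _ => ?_
      have : ∑ i, v i * A i j = 0 := congrFun hv0 j
      rw [this, zero_smul])
    exact hv (funext hli)
  refine ⟨GeneralLinearGroup.mkOfDetNeZero _ hdet, Units.ext ?_⟩
  rw [← hφ, linear_coe]
  refine Quotient.sound fun i j => ?_
  have h : ∀ i, (linearTuple (GeneralLinearGroup.mkOfDetNeZero _ hdet)).coord i = φ.coord i :=
    fun i => by
      rw [← hA]
      simp [linearTuple, smul_eq_C_mul, GeneralLinearGroup.mkOfDetNeZero]
  rw [h i, h j, mul_comm]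

end Linear

end Cremona

/-! ### Central commutators of prime order in small dimension -/

open Module in
-- On an eigenspace `E` of `C` the relation reads `A B = μ B A`. Determinants give `μ ^ dim E = 1`;
-- since `dim E < l` and `μ ^ l = 1`, `μ = 1`. Invertibility of `l` excludes a nontrivial unipotent
-- `C`.
theorem Module.End.eq_one_of_central_commutator {F V : Type*} [Field F] [IsAlgClosed F]
    [AddCommGroup V] [Module F V] [FiniteDimensional F V] {A B C : End F V}
    (hA : IsUnit A) (hB : IsUnit B) (hAB : A * B = C * B * A) (hCA : C * A = A * C)
    (hCB : C * B = B * C) {l : ℕ} (hl : l.Prime) (hlF : (l : F) ≠ 0) (hlV : finrank F V < l)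
    (hC : C ^ l = 1) : C = 1 := by
  by_contra hne
  obtain ⟨μ, hμ1, w, hw0, hw⟩ : ∃ μ : F, μ ≠ 1 ∧ ∃ w : V, w ≠ 0 ∧ C w = μ • w := by
    -- An eigenvector `w = (C - 1) y` in this stable subspace cannot have eigenvalue `1`: otherwise
    -- `∑ Cⁱ` would send `w` both to `l w` and to `(C ^ l - 1) y = 0`.
    let W := LinearMap.range (C - 1)
    have hW : Nontrivial W := by
      rw [Submodule.nontrivial_iff_ne_bot]
      intro h
      exact hne (sub_eq_zero.mp (LinearMap.range_eq_bot.mp h))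
    have hCW : ∀ x ∈ W, C x ∈ W := by
      rintro _ ⟨y, rfl⟩
      exact ⟨C y, by simp⟩
    obtain ⟨μ, hμ⟩ := Module.End.exists_eigenvalue (LinearMap.restrict C hCW)
    obtain ⟨⟨w, hwW⟩, hw⟩ := hμ.exists_hasEigenvector
    have hw1 : C w = μ • w := congrArg Subtype.val hw.apply_eq_smul
    have hw0 : w ≠ 0 := fun h => hw.2 (Subtype.ext h)
    refine ⟨μ, ?_, w, hw0, hw1⟩
    rintro rfl
    obtain ⟨y, rfl⟩ := hwW
    have hpow : ∀ i : ℕ, (C ^ i) ((C - 1) y) = (C - 1) y := fun i => by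
      induction i with
      | zero => simp
      | succ i ih => rw [pow_succ, Module.End.mul_apply, hw1, one_smul, ih]
    have hS : (∑ i ∈ Finset.range l, C ^ i) ((C - 1) y) = 0 := by
      rw [← Module.End.mul_apply, geom_sum_mul, hC, sub_self, LinearMap.zero_apply]
    rw [LinearMap.sum_apply] at hS
    simp only [hpow, Finset.sum_const, Finset.card_range] at hS
    rw [← Nat.cast_smul_eq_nsmul F] at hS
    exact (smul_ne_zero hlF hw0) hS
  have hμl : μ ^ l = 1 := by
    have hpow : ∀ i : ℕ, (C ^ i) w = μ ^ i • w := fun i => by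
      induction i with
      | zero => simp
      | succ i ih => rw [pow_succ, Module.End.mul_apply, hw, map_smul, ih, smul_smul, pow_succ']
    have h := hpow l
    rw [hC, Module.End.one_apply] at h
    have h' : (μ ^ l - 1) • w = 0 := by rw [sub_smul, one_smul, ← h, sub_self]
    exact sub_eq_zero.mp ((smul_eq_zero.mp h').resolve_right hw0)
  let E := Module.End.eigenspace C μ
  have hE : ∀ D : End F V, C * D = D * C → ∀ x ∈ E, D x ∈ E := fun D hD x hx => by
    rw [Module.End.mem_eigenspace_iff] at hx ⊢
    rw [← Module.End.mul_apply, hD, Module.End.mul_apply, hx, map_smul]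
  have hunit : ∀ (D : End F V) (hD : C * D = D * C), IsUnit D →
      LinearMap.det (LinearMap.restrict D (hE D hD)) ≠ 0 := fun D hD hu h0 => by
    have := LinearMap.bot_lt_ker_of_det_eq_zero h0
    refine this.ne' (LinearMap.ker_eq_bot.mpr fun x y hxy => Subtype.ext ?_)
    exact ((Module.End.isUnit_iff D).mp hu).injective (congrArg Subtype.val hxy)
  have hrel : LinearMap.restrict A (hE A hCA) * LinearMap.restrict B (hE B hCB)
      = μ • (LinearMap.restrict B (hE B hCB) * LinearMap.restrict A (hE A hCA)) := by
    ext ⟨x, hx⟩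
    have h := LinearMap.congr_fun hAB x
    rw [mul_assoc] at h
    exact h.trans (Module.End.mem_eigenspace_iff.mp (hE B hCB _ (hE A hCA _ hx)))
  have hdet := congrArg LinearMap.det hrel
  rw [LinearMap.det_smul, map_mul, map_mul, mul_comm (LinearMap.det (LinearMap.restrict B _))]
    at hdet
  have hμE : μ ^ finrank F E = 1 := by
    have := mul_ne_zero (hunit A hCA hA) (hunit B hCB hB)
    exact (mul_eq_right₀ this).mp hdet.symm
  have hE0 : 0 < finrank F E := by
    have : Nontrivial E := by
      rw [Submodule.nontrivial_iff_ne_bot, Submodule.ne_bot_iff]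
      exact ⟨w, Module.End.mem_eigenspace_iff.mpr hw, hw0⟩
    exact finrank_pos
  have hcop : Nat.gcd (finrank F E) l = 1 :=
    Nat.Coprime.symm (hl.coprime_iff_not_dvd.mpr fun h =>
      (Nat.le_of_dvd hE0 h).not_gt ((Submodule.finrank_le E).trans_lt hlV))
  have := pow_gcd_eq_one.mpr ⟨hμE, hμl⟩
  exact hμ1 (by rwa [hcop, pow_one] at this)

/-! ### Normal subgroups of the general linear group -/

namespace Matrix

section

variable {ι K : Type*} [Fintype ι] [DecidableEq ι] [Field K]

open Matrix.SpecialLinearGroup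

theorem transvection_mulVec_apply (i j : ι) (c : K) (v : ι → K) (l : ι) :
    (transvection i j c *ᵥ v) l = v l + if l = i then c * v j else 0 := by
  simp [transvection, add_mulVec, single_mulVec_eq, Pi.single_apply, eq_comm]

/-- Whitehead's identity: the first three and the last three factors are the Weyl elements of
parameters `c` and `-1`. -/
theorem SpecialLinearGroup.diag2n_decompose {i j : ι} (hij : i ≠ j) {c : K} (hc : c ≠ 0) :
    diag2n hij c hc = SpecialLinearGroup.transvection hij c * SpecialLinearGroup.transvection hij.symm (-c⁻¹) * SpecialLinearGroup.transvection hij c *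
      SpecialLinearGroup.transvection hij (-1) * SpecialLinearGroup.transvection hij.symm 1 * SpecialLinearGroup.transvection hij (-1) := by
  apply Subtype.ext
  change (diag2n hij c hc).1 = Matrix.transvection i j c * Matrix.transvection j i (-c⁻¹) *
    Matrix.transvection i j c * Matrix.transvection i j (-1) * Matrix.transvection j i 1 *
    Matrix.transvection i j (-1)
  apply Matrix.ext_of_mulVec_single
  intro m
  generalize (Pi.single m 1 : ι → K) = v
  funext l
  simp only [diag2n_coe, ← mulVec_mulVec,  transvection_mulVec_apply, mulVec_diagonal]
  rcases eq_or_ne l i with rfl | hli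
  · simp [hij, hij.symm]
    field_simp
    ring
  · rcases eq_or_ne l j with rfl | hlj
    · simp [hij, hij.symm]
      field_simp
      ring
    · simp [hli, hlj]

/-- The invertible diagonal matrices. -/
def diagonalGL : (ι → Kˣ) →* GL ι K :=
  (Units.map (diagonalRingHom ι K).toMonoidHom).comp MulEquiv.piUnits.symm.toMonoidHom

theorem coe_diagonalGL (d : ι → Kˣ) : (diagonalGL d).1 = diagonal (fun i => (d i : K)) := rfl

/-- The permutation matrices. -/
def permGL (K : Type*) [Field K] (e : Equiv.Perm ι) : GL ι K :=
  ⟨e.permMatrix K, e⁻¹.permMatrix K, by simp [← permMatrix_mul], by simp [← permMatrix_mul]⟩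

/-- Commutators of nonscalar diagonal matrices with transvections give all transvections, hence
`SL`; extracting a root of the determinant writes any matrix as a scalar times an element of `SL`.
-/
theorem normal_GL_eq_top [IsAlgClosed K] [Nontrivial ι] {N : Subgroup (GL ι K)} [hN : N.Normal]
    (hscalar : ∀ c : Kˣ, GeneralLinearGroup.scalar ι c ∈ N)
    {d : ι → Kˣ} (hd : diagonalGL d ∈ N) {a b : ι} (hab : d a ≠ d b) : N = ⊤ := by
  have hperm : ∀ e : Equiv.Perm ι, diagonalGL (d ∘ e) ∈ N := fun e => by
    have := hN.conj_mem _ hd (permGL K e)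
    convert this using 1
    rw [eq_mul_inv_iff_mul_eq]
    ext i j
    simp [permGL, coe_diagonalGL, Equiv.Perm.permMatrix, PEquiv.toMatrix_apply, diagonal_mul,
      Matrix.mul_diagonal]
    grind
  have hcomm : ∀ (d : ι → Kˣ), diagonalGL d ∈ N → ∀ (i j : ι) (hij : i ≠ j), d i ≠ d j →
      ∀ c : K, toGL (SpecialLinearGroup.transvection hij c) ∈ N := fun d hd i j hij hdij c => by
    -- The commutator of the diagonal matrix with the transvection of parameter `t` has parameter `t
    -- r`, whence `t = c / r`.
    obtain ⟨r, hr⟩ : ∃ r : K, r = (d i : K) / (d j : K) - 1 := ⟨_, rfl⟩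
    have hr0 : r ≠ 0 := by
      rw [hr, sub_ne_zero, Ne, div_eq_one_iff_eq (d j).ne_zero]
      exact fun h => hdij (Units.ext h)
    have h := N.mul_mem hd (N.inv_mem (hN.conj_mem _ hd (toGL (SpecialLinearGroup.transvection hij (c / r)))))
    have hDT : diagonalGL d * toGL (SpecialLinearGroup.transvection hij (c / r))
        = toGL (SpecialLinearGroup.transvection hij c) *
          (toGL (SpecialLinearGroup.transvection hij (c / r)) * diagonalGL d) := by
      apply Units.ext
      rw [← mul_assoc, ← map_mul, ← transvection_add]
      ext p q
      have hdj : (d j : K) ≠ 0 := (d j).ne_zero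
      have key : (d i : K) * (c / r) = (c + c / r) * d j := by
        have : (d i : K) = (r + 1) * d j := by rw [hr]; field_simp; ring
        rw [this]
        field_simp
      rcases eq_or_ne i p with rfl | hp <;> rcases eq_or_ne j q with rfl | hq <;>
        simp [coe_diagonalGL, transvection_coe, Matrix.diagonal_mul, Matrix.mul_diagonal,
          Matrix.one_apply, *]
      · rw [← hr]; exact key
      all_goals grind
    rwa [_root_.mul_inv_rev, _root_.mul_inv_rev, ← mul_assoc, inv_inv, hDT,
      show ∀ x y z : GL ι K, x * (y * z) * (z⁻¹ * y⁻¹) = x by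
        intro x y z; group] at h
  have htrans : ∀ (i j : ι) (hij : i ≠ j) (c : K), toGL (SpecialLinearGroup.transvection hij c) ∈ N := by
    intro i j hij c
    have hne : a ≠ b := fun h => hab (by rw [h])
    obtain ⟨e, hei, hej⟩ : ∃ e : Equiv.Perm ι, e i = a ∧ e j = b := by
      refine ⟨Equiv.swap (Equiv.swap i a j) b * Equiv.swap i a, ?_, ?_⟩
      · rw [Equiv.Perm.mul_apply, Equiv.swap_apply_left, Equiv.swap_apply_of_ne_of_ne _ hne]
        intro h
        apply hij
        exact (Equiv.swap i a).injective (by rw [Equiv.swap_apply_left, ← h])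
      · simp
    refine hcomm _ (hperm e) i j hij ?_ c
    simpa [hei, hej] using hab
  have hSL : ∀ M : SpecialLinearGroup ι K, toGL M ∈ N := fun M => by
    refine diagonal_transvection_induction' (fun M => toGL M ∈ N) M ?_ htrans ?_
    · intro i j hij c hc
      rw [diag2n_decompose hij hc]
      simp only [map_mul]
      exact N.mul_mem (N.mul_mem (N.mul_mem (N.mul_mem (N.mul_mem (htrans _ _ _ _) (htrans _ _ _ _))
        (htrans _ _ _ _)) (htrans _ _ _ _)) (htrans _ _ _ _)) (htrans _ _ _ _)
    · intro A B hA hB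
      rw [map_mul]
      exact N.mul_mem hA hB
  refine (Subgroup.eq_top_iff' N).mpr fun g => ?_
  obtain ⟨z, hz⟩ := IsAlgClosed.exists_pow_nat_eq (g.1.det) (Fintype.card_pos (α := ι))
  have hz0 : z ≠ 0 := by
    rintro rfl
    rw [zero_pow Fintype.card_ne_zero] at hz
    exact g.det_ne_zero hz.symm
  have hdet : (z⁻¹ • g.1).det = 1 := by
    rw [det_smul, ← hz, inv_pow, inv_mul_cancel₀ (pow_ne_zero _ hz0)]
  have hg : g = GeneralLinearGroup.scalar ι (Units.mk0 z hz0) * toGL ⟨z⁻¹ • g.1, hdet⟩ := by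
    apply Units.ext
    change g.1 = Matrix.scalar ι z * (z⁻¹ • g.1)
    simp [← Matrix.smul_eq_diagonal_mul, smul_smul, hz0]
  rw [hg]
  exact N.mul_mem (hscalar _) (hSL _)

end

end Matrix

namespace Cremona

open MvPolynomial Matrix

/-! ### Fibrewise inversions and the monomial map in `G` -/

section Relations

variable {k : Type*} [Field k] {n : ℕ} (hn : 0 < n)

theorem linear_mem_G (A : GL (Fin (n + 1)) k) : linear k n A ∈ G k n hn :=
  Subgroup.subset_closure (Or.inr (linear_mem_autProj A))

/-- The linear action of `GLₙ₊₁`, as a homomorphism to `Gₙ`. -/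
noncomputable def linearG : GL (Fin (n + 1)) k →* G k n hn :=
  (linear k n).codRestrict _ (linear_mem_G hn)

/-- The standard involution as an element of `Gₙ`. -/
noncomputable def sigmaG : G k n hn :=
  ⟨sigma k n hn, Subgroup.subset_closure (Or.inl rfl)⟩

/-- The birational map of `ℙⁿ` underlying an element of `Gₙ`. -/
noncomputable def G.toDomRat : G k n hn →* DomRat k n := (Units.coeHom _).comp (G k n hn).subtype

theorem G.toDomRat_injective : Function.Injective (G.toDomRat (k := k) hn) :=
  Units.val_injective.comp Subtype.val_injective

theorem sigmaG_mul_self : sigmaG hn * sigmaG hn = (1 : G k n hn) :=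
  Subtype.ext (Units.ext (sigma k n hn).mul_inv)

section

variable {L : Type*} [Field L] [Algebra k L] (v : Fin (n + 1) → L)

theorem sends_linearG (A : GL (Fin (n + 1)) k) :
    Sends (G.toDomRat hn (linearG hn A)) v (fun i => ∑ j, algebraMap k L (A i j) * v j) :=
  sends_linear A v

theorem sends_diagonalGL (d : Fin (n + 1) → kˣ) :
    Sends (G.toDomRat hn (linearG hn (diagonalGL d))) v (fun i => algebraMap k L (d i) * v i) := by
  convert sends_linearG hn v (diagonalGL d) using 2 with i
  simp [coe_diagonalGL, diagonal_apply, apply_ite (algebraMap k L)]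

theorem sends_permGL (e : Equiv.Perm (Fin (n + 1))) :
    Sends (G.toDomRat hn (linearG hn (permGL k e))) v (v ∘ e) := by
  convert sends_linearG hn v (permGL k e) using 2 with i
  simp [permGL, Equiv.Perm.permMatrix, PEquiv.toMatrix_apply]

theorem sends_transvection {a b : Fin (n + 1)} (hab : a ≠ b) (c : k) :
    Sends (G.toDomRat hn (linearG hn (SpecialLinearGroup.toGL
      (SpecialLinearGroup.transvection hab c)))) v
      (Function.update v a (v a + algebraMap k L c * v b)) := by
  convert sends_linearG hn v _ using 2 with i
  simp only [SpecialLinearGroup.coe_GL_coe_matrix, SpecialLinearGroup.transvection_coe,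
    Matrix.add_apply, map_add, add_mul, Finset.sum_add_distrib, Matrix.one_apply,
    Matrix.single_apply, Function.update_apply]
  rcases eq_or_ne i a with rfl | hi
  · simp [apply_ite (algebraMap k L)]
  · simp [hi, hi.symm, apply_ite (algebraMap k L)]

theorem sends_sigmaG {v : Fin (n + 1) → L} (hv : ∀ i, v i ≠ 0) :
    Sends (G.toDomRat hn (sigmaG hn : G k n hn)) v (fun i => (v i)⁻¹) :=
  sends_sigma hn hv

/-- The involution `(x, yᵢ) ↦ (x, x / yᵢ)` in the affine coordinates `x = z_b / z_a`,
`yᵢ = zᵢ / z_a`. -/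
noncomputable def fibreInv (k : Type*) [Field k] (a b : Fin (n + 1)) : G k n hn :=
  sigmaG hn * linearG hn (permGL k (Equiv.swap a b))

theorem sends_fibreInv {a b : Fin (n + 1)} (hab : a ≠ b) {v : Fin (n + 1) → L}
    (hv : ∀ i, v i ≠ 0) :
    Sends (G.toDomRat hn (fibreInv hn k a b)) v
      (fun i => if i = a then v a else if i = b then v b else v a * v b / v i) := by
  rw [fibreInv, map_mul]
  refine ((sends_sigmaG hn fun i => hv _).mul (sends_permGL hn v _)).of_smul (v a * v b)⁻¹
    (inv_ne_zero (mul_ne_zero (hv a) (hv b))) fun i => ?_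
  have ha := hv a
  have hb := hv b
  have hi := hv i
  rcases eq_or_ne i a with rfl | hia
  · simp; field_simp
  · rcases eq_or_ne i b with rfl | hib
    · simp [hia]; field_simp
    · simp [hia, hib, Equiv.swap_apply_of_ne_of_ne]; field_simp

/-- The map `(x, yᵢ) ↦ (x, (x - 1) / yᵢ)`, with `x = z_b / z_a` and `yᵢ = zᵢ / z_a`. -/
noncomputable def fibreInvSubOne {a b : Fin (n + 1)} (hab : a ≠ b) : G k n hn :=
  (linearG hn (SpecialLinearGroup.toGL (SpecialLinearGroup.transvection hab.symm 1))) *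
    (fibreInv hn k a b *
      linearG hn (SpecialLinearGroup.toGL (SpecialLinearGroup.transvection hab.symm (-1))))

/-- Conjugation by `x ↦ x - 1` replaces the product `z_a z_b` in `fibreInv` by `z_a (z_b - z_a)`. -/
theorem sends_fibreInvSubOne {a b : Fin (n + 1)} (hab : a ≠ b) {v : Fin (n + 1) → L}
    (hv : ∀ i, v i ≠ 0) (hvab : v b ≠ v a) :
    Sends (G.toDomRat hn (fibreInvSubOne (k := k) hn hab)) v
      (fun i => if i = a then v a else if i = b then v b else v a * (v b - v a) / v i) := by
  rw [fibreInvSubOne, map_mul, map_mul]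
  refine ((sends_transvection hn _ _ _).mul ((sends_fibreInv hn hab ?_).mul
    (sends_transvection hn v _ _))).of_smul 1 one_ne_zero fun i => ?_
  · intro i
    rcases eq_or_ne i b with rfl | hib
    · simpa [← sub_eq_add_neg, sub_ne_zero] using hvab
    · simpa [hib] using hv i
  · rcases eq_or_ne i b with rfl | hib
    · simp [hab, hab.symm]
    · rcases eq_or_ne i a with rfl | hia
      · simp [hab]
      · simp [hab, hia, hib, sub_eq_add_neg]

/-- The map `(x, yᵢ) ↦ (x, x (x - 1) / yᵢ)`, with `x = z_b / z_a` and `yᵢ = zᵢ / z_a`. -/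
noncomputable def fibreInvMulSubOne {a b : Fin (n + 1)} (hab : a ≠ b) : G k n hn :=
  linearG hn (SpecialLinearGroup.toGL (SpecialLinearGroup.transvection hab.symm 1)) *
    (linearG hn (SpecialLinearGroup.toGL (SpecialLinearGroup.transvection hab (-1))) *
      (fibreInv hn k a b *
        (linearG hn (SpecialLinearGroup.toGL (SpecialLinearGroup.transvection hab 1)) *
    linearG hn (SpecialLinearGroup.toGL (SpecialLinearGroup.transvection hab.symm (-1))))))

/-- The two inner transvections turn `(z_a, z_b)` into `(z_b, z_b - z_a)`, whose product is the new
numerator; the outer two undo them. -/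
theorem sends_fibreInvMulSubOne {a b : Fin (n + 1)} (hab : a ≠ b) {v : Fin (n + 1) → L}
    (hv : ∀ i, v i ≠ 0) (hvab : v b ≠ v a) :
    Sends (G.toDomRat hn (fibreInvMulSubOne (k := k) hn hab)) v
      (fun i => if i = a then v a else if i = b then v b else v b * (v b - v a) / v i) := by
  rw [fibreInvMulSubOne, map_mul, map_mul, map_mul, map_mul]
  refine ((sends_transvection hn _ _ _).mul ((sends_transvection hn _ _ _).mul
    ((sends_fibreInv hn hab ?_).mul ((sends_transvection hn _ _ _).mul
    (sends_transvection hn v _ _))))).of_smul 1 one_ne_zero fun i => ?_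
  · intro i
    rcases eq_or_ne i b with rfl | hib
    · simpa [← sub_eq_add_neg, sub_ne_zero, hab.symm] using hvab
    · rcases eq_or_ne i a with rfl | hia
      · simpa [hab] using hv b
      · simpa [hib, hia] using hv i
  · rcases eq_or_ne i b with rfl | hib
    · simp [hab, hab.symm]
    · rcases eq_or_ne i a with rfl | hia
      · simp [hab, hab.symm]
      · simp [hab, hab.symm, hia, hib, sub_eq_add_neg]

/-- The monomial map `(x, yᵢ) ↦ (x, x yᵢ)`, with `x = z_b / z_a` and `yᵢ = zᵢ / z_a`. -/
noncomputable def fibreMul {a b : Fin (n + 1)} (hab : a ≠ b) : G k n hn :=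
  fibreInvMulSubOne hn hab * fibreInvSubOne hn hab

/-- The inversions cancel and leave the quotient of `x (x - 1)` by `x - 1`. -/
theorem sends_fibreMul {a b : Fin (n + 1)} (hab : a ≠ b) {v : Fin (n + 1) → L}
    (hv : ∀ i, v i ≠ 0) (hvab : v b ≠ v a) :
    Sends (G.toDomRat hn (fibreMul (k := k) hn hab)) v
      (fun i => if i = a then v a else if i = b then v b else v b * v i / v a) := by
  rw [fibreMul, map_mul]
  have hba := sub_ne_zero.mpr hvab
  have ha := hv a
  refine ((sends_fibreInvMulSubOne hn hab ?_ ?_).mul (sends_fibreInvSubOne hn hab hv hvab)).of_smul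
    1 one_ne_zero fun i => ?_
  · intro i
    split_ifs
    · exact hv a
    · exact hv b
    · exact div_ne_zero (mul_ne_zero ha hba) (hv i)
  · simpa [hab.symm] using hvab
  · have hi := hv i
    rcases eq_or_ne i a with rfl | hia
    · simp
    · rcases eq_or_ne i b with rfl | hib
      · simp [hia]
      · simp [hia, hib, hab.symm]
        field_simp

end

/-! ### The Heisenberg relations -/

/-- The scaling by `s` of the coordinate `z_b`. -/
def baseScaling (b : Fin (n + 1)) (s : kˣ) : Fin (n + 1) → kˣ := Pi.mulSingle b s

/-- The scaling by `s` of the coordinates other than `z_a`, `z_b`. -/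
def fibreScaling (a b : Fin (n + 1)) (s : kˣ) : Fin (n + 1) → kˣ :=
  fun i => if i = a ∨ i = b then 1 else s

theorem G.eq_of_sends {f g : G k n hn}
    {w : Fin (n + 1) → FractionRing (MvPolynomial (Fin (n + 1)) k)}
    (hf : Sends (G.toDomRat hn f) (genericPoint k n) w)
    (hg : Sends (G.toDomRat hn g) (genericPoint k n) w) : f = g :=
  G.toDomRat_injective hn (hf.eq_of_genericPoint hg)

theorem genericPoint_injective : Function.Injective (genericPoint k n) := fun i j h => by
  by_contra hij
  exact algebraMap_mul_genericPoint_ne (k := k) hij 1 (by simpa using h.symm)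

/-- Replacing `x` by `s x` multiplies `x yᵢ` by `s`, so the commutator is the fibre scaling. -/
theorem fibreMul_mul_baseScaling {a b : Fin (n + 1)} (hab : a ≠ b) (s : kˣ) :
    fibreMul hn hab * linearG hn (diagonalGL (baseScaling b s))
      = linearG hn (diagonalGL (fibreScaling a b s)) * linearG hn (diagonalGL (baseScaling b s))
        * fibreMul hn hab := by
  refine G.eq_of_sends hn (w := fun i => if i = a then genericPoint k n a else if i = b then
    algebraMap k _ s * genericPoint k n b else
      algebraMap k _ s * genericPoint k n b * genericPoint k n i / genericPoint k n a) ?_ ?_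
  · rw [map_mul]
    refine ((sends_fibreMul hn hab ?_ ?_).mul (sends_diagonalGL hn _ _)).of_smul 1 one_ne_zero
      fun i => ?_
    · exact fun i => mul_ne_zero (by simp) (genericPoint_ne_zero i)
    · simpa [baseScaling, hab] using algebraMap_mul_genericPoint_ne hab (s : k)
    · rcases eq_or_ne i a with rfl | hia
      · simp [baseScaling, hab]
      · rcases eq_or_ne i b with rfl | hib
        · simp [hia, baseScaling]
        · simp [hia, hib, baseScaling, hab]
  · rw [map_mul, map_mul]
    refine (((sends_diagonalGL hn _ _).mul (sends_diagonalGL hn _ _)).mul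
      (sends_fibreMul hn hab genericPoint_ne_zero
        (genericPoint_injective.ne hab.symm))).of_smul 1 one_ne_zero fun i => ?_
    rcases eq_or_ne i a with rfl | hia
    · simp [baseScaling, fibreScaling, hab]
    · rcases eq_or_ne i b with rfl | hib
      · simp [hia, baseScaling, fibreScaling]
      · simp [hia, hib, baseScaling, fibreScaling]
        ring

theorem fibreMul_comm_fibreScaling {a b : Fin (n + 1)} (hab : a ≠ b) (s : kˣ) :
    linearG hn (diagonalGL (fibreScaling a b s)) * fibreMul hn hab
      = fibreMul hn hab * linearG hn (diagonalGL (fibreScaling a b s)) := by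
  refine G.eq_of_sends hn (w := fun i => if i = a then genericPoint k n a else if i = b then
    genericPoint k n b else
      algebraMap k _ s * genericPoint k n b * genericPoint k n i / genericPoint k n a) ?_ ?_
  · rw [map_mul]
    refine ((sends_diagonalGL hn _ _).mul (sends_fibreMul hn hab genericPoint_ne_zero
        (genericPoint_injective.ne hab.symm))).of_smul 1 one_ne_zero fun i => ?_
    rcases eq_or_ne i a with rfl | hia
    · simp [fibreScaling]
    · rcases eq_or_ne i b with rfl | hib
      · simp [hia, fibreScaling]
      · simp [hia, hib, fibreScaling]
        ring
  · rw [map_mul]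
    refine ((sends_fibreMul hn hab ?_ ?_).mul (sends_diagonalGL hn _ _)).of_smul 1 one_ne_zero
      fun i => ?_
    · exact fun i => mul_ne_zero (by simp) (genericPoint_ne_zero i)
    · simpa [fibreScaling] using genericPoint_injective.ne hab.symm
    · rcases eq_or_ne i a with rfl | hia
      · simp [fibreScaling]
      · rcases eq_or_ne i b with rfl | hib
        · simp [hia, fibreScaling]
        · simp [hia, hib, fibreScaling]
          ring

/-! ### The order-three relation between the standard involution and a linear map -/

/-- The matrix of the affine involution `x ↦ 1 - x` in the chart `z₀ = 1`. -/
def oneSubMatrix (k : Type*) [Field k] (n : ℕ) : Matrix (Fin (n + 1)) (Fin (n + 1)) k :=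
  Matrix.of fun i j =>
    if i = 0 then (if j = 0 then 1 else 0) else (if j = 0 then 1 else 0) - if i = j then 1 else 0

theorem sum_oneSubMatrix {R : Type*} [CommRing R] [Algebra k R] (v : Fin (n + 1) → R)
    (i : Fin (n + 1)) :
    ∑ j, algebraMap k R (oneSubMatrix k n i j) * v j = if i = 0 then v 0 else v 0 - v i := by
  rcases eq_or_ne i 0 with rfl | hi
  · simp [oneSubMatrix]
  · simp [oneSubMatrix, hi, sub_mul, Finset.sum_sub_distrib, apply_ite (algebraMap k R)]

theorem oneSubMatrix_mul_self : oneSubMatrix k n * oneSubMatrix k n = 1 := by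
  apply Matrix.ext_of_mulVec_single
  intro m
  generalize (Pi.single m 1 : Fin (n + 1) → k) = v
  have h : ∀ w : Fin (n + 1) → k, oneSubMatrix k n *ᵥ w
      = fun i => if i = 0 then w 0 else w 0 - w i := fun w => by
    funext i
    simpa [Matrix.mulVec, dotProduct] using sum_oneSubMatrix (k := k) w i
  rw [← mulVec_mulVec, h, h, one_mulVec]
  funext i
  rcases eq_or_ne i 0 with rfl | hi
  · simp
  · simp [hi]

/-- The affine involution `x ↦ 1 - x`, as a matrix in `GLₙ₊₁`. -/
def oneSub (k : Type*) [Field k] (n : ℕ) : GL (Fin (n + 1)) k :=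
  ⟨oneSubMatrix k n, oneSubMatrix k n, oneSubMatrix_mul_self, oneSubMatrix_mul_self⟩

theorem sends_oneSub {L : Type*} [Field L] [Algebra k L] (v : Fin (n + 1) → L) :
    Sends (G.toDomRat hn (linearG hn (oneSub k n))) v
      (fun i => if i = 0 then v 0 else v 0 - v i) := by
  convert sends_linearG hn v _ using 2 with i
  exact (sum_oneSubMatrix v i).symm

/-- In each affine coordinate the product is `x ↦ 1 - 1 / x`, of order three: `x ↦ (x - 1) / x ↦ -1
/ (x - 1) ↦ x`. -/
theorem oneSub_mul_sigma_pow_three :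
    (linearG hn (oneSub k n) * sigmaG hn) ^ 3 = (1 : G k n hn) := by
  have key : ∀ v : Fin (n + 1) → FractionRing (MvPolynomial (Fin (n + 1)) k), (∀ i, v i ≠ 0) →
      Sends (G.toDomRat hn (linearG hn (oneSub k n) * sigmaG hn)) v
        (fun i => if i = 0 then v 0 else v 0 * (v i - v 0) / v i) := fun v hv => by
    rw [map_mul]
    refine ((sends_oneSub hn _).mul (sends_sigmaG hn hv)).of_smul ((v 0 * v 0)⁻¹)
      (inv_ne_zero (mul_ne_zero (hv 0) (hv 0))) fun i => ?_
    have h0 := hv 0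
    have hi := hv i
    rcases eq_or_ne i 0 with rfl | hi0
    · simp; field_simp
    · simp [hi0]; field_simp
  have hz0 := genericPoint_ne_zero (k := k) (n := n) 0
  have hsub : ∀ i, i ≠ 0 → genericPoint k n i - genericPoint k n 0 ≠ 0 := fun i hi =>
    sub_ne_zero.mpr (genericPoint_injective.ne hi)
  refine G.eq_of_sends hn (w := genericPoint k n) ?_ (by rw [map_one]; exact Sends.one _)
  rw [pow_succ, pow_two, map_mul, map_mul]
  have h2 : Sends (G.toDomRat hn (linearG hn (oneSub k n) * sigmaG hn))
      (fun i => if i = 0 then genericPoint k n 0 else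
        genericPoint k n 0 * (genericPoint k n i - genericPoint k n 0) / genericPoint k n i)
      (fun i => if i = 0 then genericPoint k n 0 else
        - (genericPoint k n 0 * genericPoint k n 0) / (genericPoint k n i - genericPoint k n 0)) := by
    refine (key _ fun i => ?_).of_smul 1 one_ne_zero fun i => ?_
    · split_ifs with hi
      · exact hz0
      · exact div_ne_zero (mul_ne_zero hz0 (hsub i hi)) (genericPoint_ne_zero i)
    · rcases eq_or_ne i 0 with rfl | hi
      · simp
      · have h1 := hsub i hi
        have h2 := genericPoint_ne_zero (k := k) i
        simp [hi]
        field_simp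
        ring
  have h3 : Sends (G.toDomRat hn (linearG hn (oneSub k n) * sigmaG hn))
      (fun i => if i = 0 then genericPoint k n 0 else
        - (genericPoint k n 0 * genericPoint k n 0) / (genericPoint k n i - genericPoint k n 0))
      (genericPoint k n) := by
    refine (key _ fun i => ?_).of_smul 1 one_ne_zero fun i => ?_
    · split_ifs with hi
      · exact hz0
      · exact div_ne_zero (neg_ne_zero.mpr (mul_ne_zero hz0 hz0)) (hsub i hi)
    · rcases eq_or_ne i 0 with rfl | hi
      · simp
      · have h1 := hsub i hi
        simp [hi]
        field_simp
        ring
  exact (h3.mul h2).mul (key _ genericPoint_ne_zero)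

end Relations

end Cremona

/-! ### Triviality of representations -/

namespace Cremona

open Matrix Module

theorem natCast_ne_zero_of_ringChar_lt {K : Type*} [Field K] {l : ℕ} (hl : l.Prime)
    (h : ringChar K < l) : (l : K) ≠ 0 := fun h0 => by
  rcases (Nat.dvd_prime hl).mp ((ringChar.spec K l).mp h0) with h1 | h1
  · exact CharP.ringChar_ne_one h1
  · exact h.ne h1

/-- The case of an algebraically closed field of coefficients. -/
theorem eq_one_of_isAlgClosed {k : Type*} [Field k] [IsAlgClosed k] {n : ℕ} (hn : 2 ≤ n)
    {F : Type*} [Field F] [IsAlgClosed F] {V : Type*} [AddCommGroup V] [Module F V]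
    [FiniteDimensional F V] (ρ : G k n (Nat.zero_lt_of_lt hn) →* End F V) : ∀ g, ρ g = 1 := by
  have hn0 : 0 < n := Nat.zero_lt_of_lt hn
  -- One bound serves three purposes: primitive `l`-th roots of unity exist in `k`, `l` is
  -- invertible in `F`, and `l > dim V`.
  obtain ⟨l, hlm, hl⟩ := Nat.exists_infinite_primes (finrank F V + ringChar k + ringChar F + 1)
  have hlk : NeZero (l : k) := ⟨natCast_ne_zero_of_ringChar_lt hl (by omega)⟩
  have hlF : (l : F) ≠ 0 := natCast_ne_zero_of_ringChar_lt hl (by omega)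
  obtain ⟨z, hz⟩ := HasEnoughRootsOfUnity.exists_primitiveRoot k l
  obtain ⟨ζ, rfl⟩ := hz.isUnit hl.ne_zero
  obtain ⟨a, b, c, hab, hac, hbc⟩ := Fintype.two_lt_card_iff.mp
    (show 2 < Fintype.card (Fin (n + 1)) by rw [Fintype.card_fin]; omega)
  have hζ : ζ ≠ 1 := fun h => by
    rw [h, Units.val_one] at hz
    exact hl.ne_one (hz.unique IsPrimitiveRoot.one)
  have hζl : ζ ^ l = 1 := Units.ext (by simpa using hz.pow_eq_one)
  have hker : ρ (linearG hn0 (diagonalGL (fibreScaling a b ζ))) = 1 := by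
    refine End.eq_one_of_central_commutator (A := ρ (fibreMul hn0 hab))
      (B := ρ (linearG hn0 (diagonalGL (baseScaling b ζ)))) ((Group.isUnit _).map ρ)
      ((Group.isUnit _).map ρ) ?_ ?_ ?_ hl hlF (by omega) ?_
    · simp only [← map_mul ρ, fibreMul_mul_baseScaling]
    · simp only [← map_mul ρ, fibreMul_comm_fibreScaling]
    · simp only [← map_mul, mul_comm]
    · rw [← map_pow, ← map_pow, ← map_pow]
      convert map_one ρ
      convert map_one (linearG hn0)
      convert map_one diagonalGL
      funext i
      by_cases h : i = a ∨ i = b <;> simp [fibreScaling, h, hζl]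
  have hlin : ∀ A, ρ (linearG hn0 A) = 1 := by
    have htop : (ρ.comp (linearG hn0)).ker = ⊤ := by
      have : Nontrivial (Fin (n + 1)) := ⟨a, b, hab⟩
      -- The third index `c`, available since `n ≥ 2`, makes the matrix nonscalar: its entries are
      -- `1` at `a` and `ζ` at `c`.
      refine normal_GL_eq_top (fun s => ?_) (d := fibreScaling a b ζ) hker (a := a) (b := c) ?_
      · rw [MonoidHom.mem_ker, MonoidHom.comp_apply]
        convert map_one ρ
        exact Subtype.ext (linear_scalar s)
      · simpa [fibreScaling, hac.symm, hbc.symm] using hζ.symm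
    intro A
    have hA : A ∈ (ρ.comp (linearG hn0)).ker := htop ▸ Subgroup.mem_top A
    exact hA
  have hsigma : ρ (sigmaG hn0) = 1 := by
    have h3 := congrArg ρ (oneSub_mul_sigma_pow_three (k := k) hn0)
    rwa [map_pow, map_mul, hlin, one_mul, map_one, pow_succ, pow_two, ← map_mul,
      sigmaG_mul_self, map_one, one_mul] at h3
  have hle : G k n hn0 ≤ ρ.ker.map (G k n hn0).subtype := by
    refine (Subgroup.closure_le _).mpr ?_
    rintro f (rfl | hf)
    · exact ⟨sigmaG hn0, hsigma, rfl⟩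
    · obtain ⟨A, rfl⟩ := exists_linear_of_mem_autProj hn0 hf
      exact ⟨linearG hn0 A, hlin A, rfl⟩
  intro g
  obtain ⟨g', hg', hgg'⟩ := hle g.2
  obtain rfl : g' = g := Subtype.ext hgg'
  exact hg'

end Cremona

theorem theoremA (k : Type*) [Field k] [IsAlgClosed k] (n : ℕ) (hn : 2 ≤ n)
    (F : Type*) [Field F] (V : Type*) [AddCommGroup V] [Module F V] [FiniteDimensional F V]
    (ρ : Representation F (Cremona.G k n (Nat.zero_lt_of_lt hn)) V) :
    ∀ g, ρ g = 1 := by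
  intro g
  -- Extension of scalars to the algebraic closure is injective on endomorphisms.
  have h := Cremona.eq_one_of_isAlgClosed hn
    ((MonoidHomClass.toMonoidHom (Module.End.baseChangeHom F (AlgebraicClosure F) V)).comp ρ) g
  refine LinearMap.baseChangeHom_injective F V (AlgebraicClosure F) (N := V) ?_
  exact h.trans (LinearMap.baseChange_one _ _).symm
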